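/- Let $g:\mathbb{N}\to\mathbb{C}$ be an arithmetic function (defined on the positive integers) such that for every $\varepsilon>0$ there is a constant $C_\varepsilon$ with $|g(n)|\le C_\varepsilon n^{\varepsilon}$ for all $n\ge 1$. Let $f=\mathrm{id}\ast g$ be the Dirichlet convolution of $g$ with $\mathrm{id}(n)=n$, that is, $f(n)=\sum_{dm=n} d\,g(m)$ for $n\ge 1$. Then the series $\sum_{m\ge1}\frac{f(m)}{m^2(m+1)}$ converges absolutely, and for every $\varepsilon>0$, $$\sum_{n\le x}\frac{f([x/n])}{[x/n]}=x\sum_{m\ge1}\frac{f(m)}{m^2(m+1)}+O(x^{1/3+\varepsilon})$$ as the real number $x\to\infty$, where $[t]$ denotes the integral part of $t$, the sum on the left runs over positive integers $n\le x$, and the implied constant may depend on $\varepsilon$ and $g$. -/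

import Mathlib

/-! Since `f(m)/m` is the sum of `g(d)/d` over `d ∣ m`, the left side equals the sum over `d` of
`g(d)/d` times the number of `n ≤ x` with `d ∣ [x/n]`. With `y = x/d` and `θ = 1/d`, that number is
`∑_k ([y/k] - [y/(k+θ)])`. It is `y ∑_k θ/(k(k+θ)) + O(y^(1/3+ε))` uniformly in `θ ∈ [0,1]`
(`exists_abs_sum_floor_sub_floor_le`). As `g(d) ≪ d^(1/6)`, the errors weighted by `g(d)/d` sum to
`O(x^(1/3+ε))`, and the main terms reassemble into the stated series (`exists_hasSum_id_mul_div`).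

The uniform estimate is Voronoi's exponent for the divisor problem, with a shift. The hyperbola
method leaves sawtooth sums over `k ≤ √y`. Put `Y = y^(1/3)` and let `k` be of size `M`. By
Dirichlet, the slope of `Y^3/u` is near a fraction with denominator `q ≤ M/Y`; on `q` consecutive
integers the function is then nearly an arithmetic progression of step `-a/q`, and the sawtooth sum
is `O(1)`. Counting blocks according to their fraction gives `O(Y log Y)` of them
(`card_le_of_rat_approx`). -/

/-! ### Sawtooth sums along rational progressions -/

open Finset in
theorem sum_range_emod_of_isCoprime {q : ℕ} (hq : 0 < q) {a : ℤ} (ha : IsCoprime a (q : ℤ)) (m : ℤ) :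
    ∑ j ∈ range q, (m + j * a) % (q : ℤ) = ∑ j ∈ range q, (j : ℤ) := by
  have hq' : (0 : ℤ) < q := by exact_mod_cast hq
  have hinj : Set.InjOn (fun j : ℕ => ((m + j * a) % (q : ℤ)).toNat) (range q : Set ℕ) := by
    intro i hi j hj hij
    simp only [coe_range, Set.mem_Iio] at hi hj
    have h1 := Int.emod_nonneg (m + i * a) hq'.ne'
    have h2 := Int.emod_nonneg (m + j * a) hq'.ne'
    have h3 : (m + i * a) % (q : ℤ) = (m + j * a) % (q : ℤ) := by
      simp only at hij; omega
    have h4 : (q : ℤ) ∣ ((j : ℤ) - i) * a := by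
      have := Int.ModEq.dvd h3
      convert this using 1; ring
    have h5 : (q : ℤ) ∣ (j : ℤ) - i := ha.symm.dvd_of_dvd_mul_right h4
    have h6 : (i : ℤ) ≡ j [ZMOD q] := (Int.modEq_iff_dvd).2 h5
    have h7 : i ≡ j [MOD q] := (Int.natCast_modEq_iff).1 h6
    exact Nat.ModEq.eq_of_lt_of_lt h7 hi hj
  have himg : (range q).image (fun j : ℕ => ((m + j * a) % (q : ℤ)).toNat) = range q := by
    apply eq_of_subset_of_card_le
    · intro i hi
      obtain ⟨j, -, rfl⟩ := mem_image.1 hi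
      have := Int.emod_lt_of_pos (m + j * a) hq'
      have h1 := Int.emod_nonneg (m + j * a) hq'.ne'
      simp only [mem_range]; omega
    · rw [card_image_of_injOn hinj]
  calc _ = ∑ j ∈ range q, ((((m + j * a) % (q : ℤ)).toNat : ℕ) : ℤ) := by
        refine sum_congr rfl fun j _ => ?_
        rw [Int.toNat_of_nonneg (Int.emod_nonneg _ hq'.ne')]
    _ = ∑ i ∈ (range q).image (fun j : ℕ => ((m + j * a) % (q : ℤ)).toNat), (i : ℤ) := by
        rw [sum_image hinj]
    _ = _ := by rw [himg]

theorem fract_intCast_add_div {q : ℕ} (hq : 0 < q) (n : ℤ) {r : ℝ} (hr0 : 0 ≤ r) (hr1 : r < 1) :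
    Int.fract ((n + r) / (q : ℝ)) = (((n % (q : ℤ) : ℤ) : ℝ) + r) / q := by
  have hq' : (0 : ℤ) < q := by exact_mod_cast hq
  have hqr : (0 : ℝ) < q := by exact_mod_cast hq
  have h1 := Int.emod_nonneg n hq'.ne'
  have h2 := Int.emod_lt_of_pos n hq'
  have h1' : (0 : ℝ) ≤ ((n % (q : ℤ) : ℤ) : ℝ) := by exact_mod_cast h1
  have h2' : ((n % (q : ℤ) : ℤ) : ℝ) + 1 ≤ q := by exact_mod_cast h2
  rw [Int.fract_eq_iff]
  refine ⟨by positivity, by rw [div_lt_one hqr]; linarith, n / (q : ℤ), ?_⟩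
  have h3 : (n : ℝ) = ((n % (q : ℤ) : ℤ) : ℝ) + q * ((n / (q : ℤ) : ℤ) : ℝ) := by
    exact_mod_cast (Int.emod_add_mul_ediv n q).symm
  field_simp
  linarith

open Finset in
-- The integers `⌊qβ⌋ + ja` run through all residues mod `q`, so the fractional parts are `(i +
-- {qβ})/q` for `0 ≤ i < q`, in some order.
theorem sum_fract_add_mul_div {q : ℕ} (hq : 0 < q) {a : ℤ} (ha : IsCoprime a (q : ℤ)) (β : ℝ) :
    ∑ j ∈ range q, (Int.fract (β + j * (a / q)) - 1 / 2) = Int.fract (q * β) - 1 / 2 := by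
  have hqr : (0 : ℝ) < q := by exact_mod_cast hq
  have h1 : ∀ j ∈ range q, Int.fract (β + j * (a / q)) - 1 / 2 =
      (((⌊q * β⌋ + j * a) % (q : ℤ) : ℤ) : ℝ) / q + (Int.fract (q * β) / q - 1 / 2) := by
    intro j _
    have h2 : β + j * (a / q) = (((⌊q * β⌋ + j * a : ℤ) : ℝ) + Int.fract (q * β)) / q := by
      have := Int.floor_add_fract (q * β)
      have h3 : (β + j * (a / q)) * q = q * β + j * a := by field_simp
      rw [eq_div_iff hqr.ne', h3]
      push_cast
      linarith
    rw [h2, fract_intCast_add_div hq _ (Int.fract_nonneg _) (Int.fract_lt_one _)]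
    ring
  rw [sum_congr rfl h1, sum_add_distrib, ← sum_div, ← Int.cast_sum,
    sum_range_emod_of_isCoprime hq ha]
  have h3 : ((∑ j ∈ range q, (j : ℤ) : ℤ) : ℝ) * 2 = q * (q - 1) := by
    have := Finset.sum_range_id_mul_two q
    obtain ⟨p, rfl⟩ : ∃ p, q = p + 1 := ⟨q - 1, by omega⟩
    have h4 : ((∑ j ∈ range (p + 1), j : ℕ) : ℝ) * 2 = (p + 1) * p := by exact_mod_cast this
    push_cast at h4 ⊢
    linarith
  rw [sum_const, card_range, nsmul_eq_mul]
  field_simp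
  linarith

open Finset in
-- The fractional part can jump, but it never increases by more than its argument does. Comparing
-- `u` with the exact progression shifted by `-δ` and by `+δ` therefore bounds the sum from both
-- sides, at a cost of `2δ` per term.
theorem abs_sum_fract_le_of_abs_sub_le {q : ℕ} (hq : 0 < q) {a : ℤ} (ha : IsCoprime a (q : ℤ))
    (β δ : ℝ) (u : ℕ → ℝ) (hu : ∀ j < q, |u j - (β + j * (a / q))| ≤ δ) :
    |∑ j ∈ range q, (Int.fract (u j) - 1 / 2)| ≤ 1 / 2 + 2 * q * δ := by
  have key : ∀ v w : ℝ, v ≤ w → Int.fract w - 1 / 2 ≤ Int.fract v - 1 / 2 + (w - v) := by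
    intro v w hvw
    have : (⌊v⌋ : ℝ) ≤ ⌊w⌋ := by exact_mod_cast Int.floor_le_floor hvw
    unfold Int.fract
    linarith
  have hup : ∑ j ∈ range q, (Int.fract (u j) - 1 / 2) ≤
      ∑ j ∈ range q, ((Int.fract ((β - δ) + j * (a / q)) - 1 / 2) + 2 * δ) := by
    refine sum_le_sum fun j hj => ?_
    have h := abs_le.1 (hu j (mem_range.1 hj))
    have := key ((β - δ) + j * (a / q)) (u j) (by linarith)
    linarith
  have hlo : ∑ j ∈ range q, ((Int.fract ((β + δ) + j * (a / q)) - 1 / 2) - 2 * δ) ≤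
      ∑ j ∈ range q, (Int.fract (u j) - 1 / 2) := by
    refine sum_le_sum fun j hj => ?_
    have h := abs_le.1 (hu j (mem_range.1 hj))
    have := key (u j) ((β + δ) + j * (a / q)) (by linarith)
    linarith
  rw [sum_add_distrib, sum_fract_add_mul_div hq ha, sum_const, card_range, nsmul_eq_mul] at hup
  rw [sum_sub_distrib, sum_fract_add_mul_div hq ha, sum_const, card_range, nsmul_eq_mul] at hlo
  have h1 := Int.fract_lt_one (q * (β - δ))
  have h2 := Int.fract_nonneg (q * (β + δ))
  rw [abs_le]
  constructor <;> linarith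

/-! ### Greedy blocks and separated points -/

open Finset in
/-- Greedy partition of an interval into consecutive blocks `[s, s + q s)`. -/
theorem exists_separated_finset_abs_sum_le {w : ℕ → ℝ} (hw : ∀ k, |w k| ≤ 1) {q : ℕ → ℕ} {Q B : ℕ}
    (hq : ∀ s, 0 < q s) (hQ : ∀ s, q s ≤ Q) {c : ℝ} (A : ℕ)
    (hblock : ∀ s, A ≤ s → s + q s ≤ B → |∑ j ∈ range (q s), w (s + j)| ≤ c) :
    ∃ T : Finset ℕ, (∀ s ∈ T, A ≤ s ∧ s < B) ∧ (∀ s ∈ T, ∀ t ∈ T, s < t → s + q s ≤ t) ∧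
      |∑ k ∈ Ico A B, w k| ≤ c * T.card + Q := by
  induction hn : B - A using Nat.strong_induction_on generalizing A with
  | _ n ih =>
    by_cases hAB : A + q A ≤ B
    · have hqA := hq A
      obtain ⟨T, hT1, hT2, hT3⟩ := ih (B - (A + q A)) (by omega) (A + q A)
        (fun s hs => hblock s (by omega)) rfl
      have hA : A ∉ T := fun h => by have := hT1 A h; omega
      refine ⟨insert A T, ?_, ?_, ?_⟩
      · intro s hs
        rcases mem_insert.1 hs with rfl | hs
        · omega
        · have := hT1 s hs; omega
      · intro s hs t ht hst
        rcases mem_insert.1 hs with hs' | hs' <;> rcases mem_insert.1 ht with ht' | ht'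
        · omega
        · subst hs'; exact (hT1 t ht').1
        · have := hT1 s hs'; omega
        · exact hT2 s hs' t ht' hst
      · rw [card_insert_of_notMem hA, ← sum_Ico_consecutive w (Nat.le_add_right A (q A)) hAB,
          sum_Ico_eq_sum_range w A (A + q A), Nat.add_sub_cancel_left]
        have h1 := hblock A le_rfl hAB
        push_cast
        calc _ ≤ _ := abs_add_le _ _
          _ ≤ c + (c * T.card + Q) := add_le_add h1 hT3
          _ = _ := by ring
    · refine ⟨∅, by simp, by simp, ?_⟩
      calc |∑ k ∈ Ico A B, w k| ≤ ∑ k ∈ Ico A B, |w k| := abs_sum_le_sum_abs _ _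
        _ ≤ ∑ k ∈ Ico A B, (1 : ℝ) := sum_le_sum fun k _ => hw k
        _ = ((B - A : ℕ) : ℝ) := by simp
        _ ≤ (Q : ℝ) := by
          have := hQ A
          exact_mod_cast (by omega : B - A ≤ Q)
        _ = _ := by simp

open Finset in
theorem card_le_of_separated {T : Finset ℕ} {q : ℕ} (hq : 0 < q) {L : ℝ} (hL : 0 ≤ L)
    (hsep : ∀ s ∈ T, ∀ t ∈ T, s < t → s + q ≤ t)
    (hlen : ∀ s ∈ T, ∀ t ∈ T, s < t → (t : ℝ) - s ≤ L) : (T.card : ℝ) ≤ L / q + 1 := by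
  have hqr : (0 : ℝ) < q := by exact_mod_cast hq
  rcases T.eq_empty_or_nonempty with rfl | hne
  · simp; positivity
  set m := T.min' hne with hm
  have hmT : m ∈ T := T.min'_mem hne
  have hmle : ∀ s ∈ T, m ≤ s := fun s hs => T.min'_le s hs
  have hcard : T.card ≤ (range (⌊L / q⌋₊ + 1)).card := by
    apply card_le_card_of_injOn (fun s => (s - m) / q)
    · intro s hs
      have hs' : s ∈ T := hs
      have hms := hmle s hs'
      simp only [coe_range, Set.mem_Iio, Nat.lt_succ_iff]
      apply Nat.le_floor
      have h1 : (((s - m) / q : ℕ) : ℝ) ≤ ((s - m : ℕ) : ℝ) / q := Nat.cast_div_le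
      refine h1.trans ?_
      gcongr
      rcases hms.eq_or_lt with h | h
      · rw [← h]; simpa using hL
      · rw [Nat.cast_sub hms]; exact hlen m hmT s hs' h
    · have aux : ∀ s ∈ T, ∀ t ∈ T, s < t → (s - m) / q < (t - m) / q := by
        intro s hs t ht hst
        have h1 := hsep s hs t ht hst
        have h2 := hmle s hs
        calc (s - m) / q < (s - m) / q + 1 := Nat.lt_succ_self _
          _ = (s - m + q) / q := (Nat.add_div_right _ hq).symm
          _ ≤ (t - m) / q := Nat.div_le_div_right (by omega)
      intro s hs t ht hst
      rcases lt_trichotomy s t with h | h | h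
      · exact absurd hst (aux s hs t ht h).ne
      · exact h
      · exact absurd hst (aux t ht s hs h).ne'
  rw [card_range] at hcard
  calc (T.card : ℝ) ≤ ((⌊L / q⌋₊ + 1 : ℕ) : ℝ) := by exact_mod_cast hcard
    _ ≤ _ := by push_cast; gcongr; exact Nat.floor_le (by positivity)

/-! ### Dyadic sawtooth bound by Dirichlet approximation -/

open Finset in
-- Linearise `Y^3/u` at `u = s + θ`. Over the block, replacing the slope by `-r` costs at most
-- `1/(Q+1)` and the quadratic remainder at most `Y^3 q^2/M^3`. As `q ≤ Q ≤ M/Y`, multiplying by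
-- `2q` makes each at most `2`, and `1/2 + 2 + 2 ≤ 5`.
theorem abs_sum_fract_hyperbola_block_le {Y M θ η : ℝ} (hY : 0 < Y) (hM : 0 < M) (hθ : 0 ≤ θ)
    {Q s : ℕ} (hQ : Q ≤ M / Y) (hs : M ≤ s) {r : ℚ}
    (hr : |Y ^ 3 / (s + θ) ^ 2 - r| ≤ 1 / ((Q + 1) * r.den)) (hrQ : r.den ≤ Q) :
    |∑ j ∈ range r.den, (Int.fract (Y ^ 3 / (((s + j : ℕ) : ℝ) + θ) - η) - 1 / 2)| ≤ 5 := by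
  set q := r.den with hq
  have hq0 : 0 < q := r.den_pos
  have hqr : (0 : ℝ) < q := by exact_mod_cast hq0
  have hqQ : (q : ℝ) ≤ Q := by exact_mod_cast hrQ
  have hcop : IsCoprime (-r.num) (q : ℤ) := by
    rw [IsCoprime.neg_left_iff, Int.isCoprime_iff_gcd_eq_one]
    exact r.reduced
  have hrr : (r : ℝ) = (r.num : ℝ) / q := by rw [hq]; exact Rat.cast_def r
  set u : ℝ := s + θ with hu
  have huM : M ≤ u := by linarith
  have hu0 : 0 < u := by linarith
  have hYQ : Y * Q ≤ M := by rwa [le_div_iff₀ hY, mul_comm] at hQ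
  have hYq : Y * q ≤ M := (mul_le_mul_of_nonneg_left hqQ hY.le).trans hYQ
  have h := abs_sum_fract_le_of_abs_sub_le hq0 hcop (Y ^ 3 / u - η)
    (1 / (Q + 1) + Y ^ 3 * q ^ 2 / M ^ 3)
    (fun j => Y ^ 3 / (((s + j : ℕ) : ℝ) + θ) - η) ?_
  · refine h.trans ?_
    have h1 : q * (1 / ((Q : ℝ) + 1)) ≤ 1 := by
      rw [mul_one_div, div_le_one (by positivity)]; linarith
    have h2 : q * (Y ^ 3 * q ^ 2 / M ^ 3) ≤ 1 := by
      rw [← mul_div_assoc, div_le_one (by positivity)]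
      calc _ = (Y * q) ^ 3 := by ring
        _ ≤ _ := by gcongr
    linarith
  · intro j hj
    have hjr : (j : ℝ) ≤ q := by exact_mod_cast hj.le
    have hj0 : (0 : ℝ) ≤ j := by positivity
    have e1 : Y ^ 3 / (((s + j : ℕ) : ℝ) + θ) - η - (Y ^ 3 / u - η + j * (((-r.num : ℤ) : ℝ) / q)) =
        Y ^ 3 * j ^ 2 / (u ^ 2 * (u + j)) - j * (Y ^ 3 / u ^ 2 - r) := by
      have : ((s + j : ℕ) : ℝ) + θ = u + j := by push_cast; ring
      rw [this, hrr]
      have : u + j ≠ 0 := by positivity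
      push_cast
      field_simp
      ring
    rw [e1]
    have e2 : |Y ^ 3 * j ^ 2 / (u ^ 2 * (u + j))| ≤ Y ^ 3 * q ^ 2 / M ^ 3 := by
      rw [abs_of_nonneg (by positivity)]
      have : M ^ 3 ≤ u ^ 2 * (u + j) := by
        calc M ^ 3 = M ^ 2 * M := by ring
          _ ≤ _ := by gcongr; linarith
      gcongr
    have e3 : |j * (Y ^ 3 / u ^ 2 - r)| ≤ 1 / (Q + 1) := by
      rw [abs_mul, abs_of_nonneg hj0]
      calc _ ≤ (q : ℝ) * (1 / ((Q + 1) * q)) := by gcongr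
        _ = _ := by field_simp
    rw [sub_eq_add_neg]
    refine (abs_add_le _ _).trans ?_
    rw [abs_neg]
    linarith

/-- Two points sharing the approximation `r` have slopes within `2/((Q+1)q)`, while `Y^3/u^2` falls
at rate at least `Y^3/(4M^3)` on this range. -/
theorem sub_le_of_abs_sub_le_div {Y M θ r q : ℝ} (hY : 0 < Y) (hM : 0 < M) (hq : 0 < q)
    (hθ : 0 ≤ θ) {Q : ℝ} (hQ : M / Y ≤ Q + 1) {s t : ℝ} (hs : M ≤ s) (hst : s < t)
    (ht : t + θ ≤ 2 * M) (hsr : |Y ^ 3 / (s + θ) ^ 2 - r| ≤ 1 / ((Q + 1) * q))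
    (htr : |Y ^ 3 / (t + θ) ^ 2 - r| ≤ 1 / ((Q + 1) * q)) : t - s ≤ 8 * M ^ 2 / (Y ^ 2 * q) := by
  have hMY : 0 < M / Y := by positivity
  have h1 : Y ^ 3 / (s + θ) ^ 2 - Y ^ 3 / (t + θ) ^ 2 ≤ 2 / (M / Y * q) := by
    have a1 := (abs_le.1 hsr).2
    have a2 := (abs_le.1 htr).1
    have : 1 / ((Q + 1) * q) ≤ 1 / (M / Y * q) := by gcongr
    have e : 2 / (M / Y * q) = 2 * (1 / (M / Y * q)) := by ring
    linarith
  have h2 : Y ^ 3 * (t - s) / (4 * M ^ 3) ≤ Y ^ 3 / (s + θ) ^ 2 - Y ^ 3 / (t + θ) ^ 2 := by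
    set u := s + θ
    set v := t + θ
    have hu : 0 < u := by simp only [u]; linarith
    have hv : 0 < v := by simp only [v]; linarith
    have huv : u ≤ v := by simp only [u, v]; linarith
    have e : Y ^ 3 / u ^ 2 - Y ^ 3 / v ^ 2 = Y ^ 3 * (t - s) * (1 / (u * v ^ 2) + 1 / (u ^ 2 * v)) := by
      have : t - s = v - u := by simp only [u, v]; ring
      rw [this]; field_simp; ring
    rw [e, div_eq_mul_one_div]
    have hts : 0 ≤ t - s := by linarith
    have b1 : 1 / (8 * M ^ 3) ≤ 1 / (u * v ^ 2) := by
      apply one_div_le_one_div_of_le (by positivity)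
      calc u * v ^ 2 ≤ (2 * M) * (2 * M) ^ 2 := by gcongr; linarith
        _ = _ := by ring
    have b2 : 1 / (8 * M ^ 3) ≤ 1 / (u ^ 2 * v) := by
      apply one_div_le_one_div_of_le (by positivity)
      calc u ^ 2 * v ≤ (2 * M) ^ 2 * (2 * M) := by gcongr; linarith
        _ = _ := by ring
    have b3 : 1 / (4 * M ^ 3) = 1 / (8 * M ^ 3) + 1 / (8 * M ^ 3) := by ring
    rw [b3]
    gcongr
  have h3 := h2.trans h1
  rw [div_le_div_iff₀ (by positivity) (by positivity)] at h3
  rw [le_div_iff₀ (by positivity)]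
  have h4 : Y ^ 3 * (t - s) * (M / Y * q) = M * ((t - s) * (Y ^ 2 * q)) := by
    field_simp
  rw [h4] at h3
  have h5 : 2 * (4 * M ^ 3) = M * (8 * M ^ 2) := by ring
  rw [h5] at h3
  exact le_of_mul_le_mul_left h3 hM

open Finset in
-- Block starts with a common fraction `a/q` are `q`-separated in a stretch of length at most `L/q`,
-- so there are at most `L/q^2 + 1` of them. At most `3Φq` numerators occur for each `q`. Summing
-- over `q ≤ Q` gives `ΦL log Y + ΦQ^2`, and both `ΦL` and `ΦQ^2` are `O(Y)`.
theorem card_le_of_rat_approx {Y θ : ℝ} (hY : 1 ≤ Y) (hθ0 : 0 ≤ θ) (hθ1 : θ ≤ 1) {M Q : ℕ}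
    (hYM : Y ≤ M) (hMY : (M : ℝ) ^ 2 ≤ Y ^ 3) (hQ1 : (Q : ℝ) ≤ M / Y) (hQ2 : M / Y ≤ (Q : ℝ) + 1)
    {r : ℕ → ℚ} (hr : ∀ s, |Y ^ 3 / (s + θ) ^ 2 - r s| ≤ 1 / ((Q + 1) * (r s).den))
    (hrQ : ∀ s, (r s).den ≤ Q) {T : Finset ℕ} (hT : ∀ s ∈ T, M ≤ s ∧ s < 2 * M)
    (hsep : ∀ s ∈ T, ∀ t ∈ T, s < t → s + (r s).den ≤ t) :
    (T.card : ℝ) ≤ 27 * Y * (1 + Real.log Y) := by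
  have hY0 : 0 < Y := by linarith
  have hM0 : (0 : ℝ) < M := by linarith
  set Φ : ℝ := Y ^ 3 / M ^ 2 with hΦ
  have hΦ1 : 1 ≤ Φ := by rw [hΦ, one_le_div (by positivity)]; exact hMY
  set L : ℝ := 8 * M ^ 2 / Y ^ 2 with hL
  have hfib : ∀ q ∈ Icc 1 Q, ((T.filter fun s => (r s).den = q).card : ℝ) ≤
      3 * Φ * L * ((q : ℝ)⁻¹) + 3 * Φ * Q := by
    intro q hq
    obtain ⟨hq1, hqQ⟩ := mem_Icc.1 hq
    have hqr : (1 : ℝ) ≤ q := by exact_mod_cast hq1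
    have hqQr : (q : ℝ) ≤ Q := by exact_mod_cast hqQ
    -- The slope is in `[0, Φ]` and `a` is within `1/(Q+1) < 1` of `q` times it, so `-1 < a ≤ qΦ +
    -- 1`.
    set A : ℤ := ⌊q * Φ + 1⌋ with hA
    have hA0 : 0 ≤ A := Int.floor_nonneg.2 (by positivity)
    have hmaps : ∀ s ∈ T.filter (fun s => (r s).den = q), (r s).num ∈ Icc (0 : ℤ) A := by
      intro s hs
      obtain ⟨hsT, hsq⟩ := mem_filter.1 hs
      have hsM : (M : ℝ) ≤ s := by exact_mod_cast (hT s hsT).1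
      have h1 := hr s
      have h2 : ((r s : ℚ) : ℝ) = ((r s).num : ℝ) / q := by rw [← hsq]; exact Rat.cast_def _
      rw [h2, hsq] at h1
      have h3 : |q * (Y ^ 3 / (s + θ) ^ 2) - (r s).num| ≤ 1 / ((Q : ℝ) + 1) := by
        have e : q * (Y ^ 3 / (s + θ) ^ 2) - (r s).num =
            q * (Y ^ 3 / (s + θ) ^ 2 - (r s).num / q) := by field_simp
        rw [e, abs_mul, abs_of_nonneg (by positivity)]
        calc _ ≤ (q : ℝ) * (1 / ((Q + 1) * q)) := by gcongr
          _ = _ := by field_simp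
      have h4 : 1 / ((Q : ℝ) + 1) < 1 := by
        rw [div_lt_one (by positivity)]; linarith
      have h5 : Y ^ 3 / (s + θ) ^ 2 ≤ Φ := by
        rw [hΦ]; gcongr; linarith
      have h6 : 0 ≤ q * (Y ^ 3 / (s + θ) ^ 2) := by positivity
      have h7 : q * (Y ^ 3 / (s + θ) ^ 2) ≤ q * Φ := by gcongr
      have h8 := abs_le.1 h3
      rw [mem_Icc]
      constructor
      · have : (-1 : ℝ) < (r s).num := by linarith
        have : (-1 : ℤ) < (r s).num := by exact_mod_cast this
        omega
      · apply Int.le_floor.2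
        linarith
    rw [card_eq_sum_card_fiberwise hmaps]
    push_cast
    have hone : ∀ a ∈ Icc (0 : ℤ) A,
        (((T.filter (fun s => (r s).den = q)).filter (fun s => (r s).num = a)).card : ℝ) ≤
          L / q / q + 1 := by
      intro a _
      apply card_le_of_separated hq1 (by positivity)
      · intro s hs t ht hst
        simp only [mem_filter] at hs ht
        have := hsep s hs.1.1 t ht.1.1 hst
        rwa [hs.1.2] at this
      · intro s hs t ht hst
        simp only [mem_filter] at hs ht
        have hrst : r t = r s := by
          apply Rat.ext
          · rw [hs.2, ht.2]
          · rw [hs.1.2, ht.1.2]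
        have h1 := hr s
        have h2 := hr t
        rw [hrst] at h2
        rw [hs.1.2] at h1 h2
        have hsM : (M : ℝ) ≤ s := by exact_mod_cast (hT s hs.1.1).1
        have htM : (t : ℝ) + 1 ≤ 2 * M := by exact_mod_cast (hT t ht.1.1).2
        have := sub_le_of_abs_sub_le_div hY0 hM0 (by positivity) hθ0 hQ2 hsM
          (by exact_mod_cast hst) (by linarith) h1 h2
        rwa [hL, div_div]
    calc _ ≤ ∑ a ∈ Icc (0 : ℤ) A, (L / q / q + 1) := sum_le_sum hone
      _ = ((A + 1).toNat : ℝ) * (L / q / q + 1) := by simp; ring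
      _ ≤ (3 * Φ * q) * (L / q / q + 1) := by
        gcongr
        have h1 : (((A + 1).toNat : ℤ) : ℝ) = A + 1 := by
          rw [Int.toNat_of_nonneg (by omega)]; push_cast; ring
        have h2 : (A : ℝ) ≤ q * Φ + 1 := Int.floor_le _
        have h3 : 1 ≤ q * Φ := by nlinarith
        have h4 : (((A + 1).toNat : ℕ) : ℝ) = A + 1 := by exact_mod_cast h1
        rw [h4]; linarith
      _ = 3 * Φ * L * ((q : ℝ)⁻¹) + 3 * Φ * q := by field_simp
      _ ≤ _ := by gcongr
  have hQY : (Q : ℝ) ^ 2 * Y ^ 2 ≤ M ^ 2 := by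
    rw [← mul_pow]
    rw [le_div_iff₀ hY0] at hQ1
    gcongr
  have hQleY : (Q : ℝ) ≤ Y := by
    have : (Q : ℝ) ^ 2 * Y ^ 2 ≤ Y * Y ^ 2 := by nlinarith
    have : (Q : ℝ) ^ 2 ≤ Y := le_of_mul_le_mul_right this (by positivity)
    nlinarith
  have hharm : ∑ q ∈ Icc 1 Q, (q : ℝ)⁻¹ ≤ 1 + Real.log Y := by
    have h1 := harmonic_le_one_add_log Q
    rw [harmonic_eq_sum_Icc] at h1
    push_cast at h1
    rcases Nat.eq_zero_or_pos Q with h0 | h0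
    · subst h0; simpa using by have := Real.log_nonneg hY; linarith
    · refine h1.trans ?_
      have : (0 : ℝ) < Q := by exact_mod_cast h0
      gcongr
  have hmapsden : ∀ s ∈ T, (r s).den ∈ Icc 1 Q := fun s _ =>
    mem_Icc.2 ⟨(r s).den_pos, hrQ s⟩
  rw [card_eq_sum_card_fiberwise hmapsden]
  push_cast
  have hlog := Real.log_nonneg hY
  calc _ ≤ ∑ q ∈ Icc 1 Q, (3 * Φ * L * ((q : ℝ)⁻¹) + 3 * Φ * Q) := sum_le_sum hfib
    _ = 3 * Φ * L * ∑ q ∈ Icc 1 Q, (q : ℝ)⁻¹ + 3 * Φ * Q ^ 2 := by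
      rw [sum_add_distrib, ← mul_sum]; simp; ring
    _ ≤ 24 * Y * (1 + Real.log Y) + 3 * Y := by
      have e : 3 * Φ * L = 24 * Y := by rw [hΦ, hL]; field_simp; ring
      rw [e]
      have e2 : Φ * Q ^ 2 ≤ Y := by
        rw [hΦ, div_mul_eq_mul_div, div_le_iff₀ (by positivity)]
        calc Y ^ 3 * (Q : ℝ) ^ 2 = Y * (Q ^ 2 * Y ^ 2) := by ring
          _ ≤ Y * M ^ 2 := by gcongr
      have : 24 * Y * ∑ q ∈ Icc 1 Q, (q : ℝ)⁻¹ ≤ 24 * Y * (1 + Real.log Y) := by gcongr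
      linarith
    _ ≤ _ := by nlinarith

open Finset in
theorem abs_sum_fract_hyperbola_dyadic_le {Y θ : ℝ} (η : ℝ) (hY : 1 ≤ Y) (hθ0 : 0 ≤ θ)
    (hθ1 : θ ≤ 1) {M N : ℕ} (hYM : Y ≤ M) (hMY : (M : ℝ) ^ 2 ≤ Y ^ 3) (hN : N ≤ 2 * M) :
    |∑ k ∈ Ico M N, (Int.fract (Y ^ 3 / (k + θ) - η) - 1 / 2)| ≤ 136 * Y * (1 + Real.log Y) := by
  have hY0 : 0 < Y := by linarith
  have hM0 : (0 : ℝ) < M := by linarith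
  -- At `q = M/Y` the accumulated quadratic error `q · Y^3 q^2/M^3` reaches `1`.
  set Q : ℕ := ⌊M / Y⌋₊ with hQ
  have hQ1 : (Q : ℝ) ≤ M / Y := Nat.floor_le (by positivity)
  have hQ2 : M / Y ≤ (Q : ℝ) + 1 := (Nat.lt_floor_add_one _).le
  have hQ0 : 0 < Q := Nat.floor_pos.2 (by rwa [one_le_div hY0])
  choose r hr hrQ using fun s : ℕ =>
    Real.exists_rat_abs_sub_le_and_den_le (Y ^ 3 / ((s : ℝ) + θ) ^ 2) hQ0
  obtain ⟨T, hT1, hT2, hT3⟩ := exists_separated_finset_abs_sum_le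
    (w := fun k : ℕ => Int.fract (Y ^ 3 / (k + θ) - η) - 1 / 2) (q := fun s => (r s).den)
    (Q := Q) (B := N) (c := 5)
    (fun k => by
      have h1 := Int.fract_nonneg (Y ^ 3 / (k + θ) - η)
      have h2 := Int.fract_lt_one (Y ^ 3 / (k + θ) - η)
      rw [abs_le]; constructor <;> linarith)
    (fun s => (r s).den_pos) hrQ M
    (fun s hs _ => abs_sum_fract_hyperbola_block_le hY0 hM0 hθ0 hQ1 (by exact_mod_cast hs)
      (hr s) (hrQ s))
  have hcard := card_le_of_rat_approx hY hθ0 hθ1 hYM hMY hQ1 hQ2 hr hrQ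
    (fun s hs => ⟨(hT1 s hs).1, (hT1 s hs).2.trans_le hN⟩) hT2
  have hlog := Real.log_nonneg hY
  have hQY : (Q : ℝ) ≤ Y := by
    have : (Q : ℝ) ^ 2 * Y ^ 2 ≤ Y * Y ^ 2 := by
      rw [le_div_iff₀ hY0] at hQ1
      calc (Q : ℝ) ^ 2 * Y ^ 2 = (Q * Y) ^ 2 := by ring
        _ ≤ (M : ℝ) ^ 2 := by gcongr
        _ ≤ _ := by linarith
    have : (Q : ℝ) ^ 2 ≤ Y := le_of_mul_le_mul_right this (by positivity)
    nlinarith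
  have : 0 ≤ Y * Real.log Y := by positivity
  -- The constant is `136 = 5 · 27 + 1`: at most `5` per block, plus the incomplete block of length
  -- at most `Q ≤ Y`.
  refine hT3.trans ?_
  linarith

open Finset in
-- Halving `K` costs one dyadic bound per step; once `K < 2Y`, the trivial bound `K/2` suffices.
theorem abs_sum_fract_hyperbola_le {Y θ : ℝ} (η : ℝ) (hY : 1 ≤ Y) (hθ0 : 0 ≤ θ)
    (hθ1 : θ ≤ 1) (n K : ℕ) (hK : K < 2 ^ n) (hKY : (K : ℝ) ^ 2 ≤ Y ^ 3) :
    |∑ k ∈ Ico 1 (K + 1), (Int.fract (Y ^ 3 / (k + θ) - η) - 1 / 2)| ≤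
      136 * Y * (1 + Real.log Y) * (n + 1) := by
  have hlog := Real.log_nonneg hY
  induction n generalizing K with
  | zero =>
    have : K = 0 := by simpa using hK
    subst this
    simp
    positivity
  | succ n ih =>
    rcases lt_or_ge (K : ℝ) (2 * Y) with h | h
    · calc _ ≤ ∑ k ∈ Ico 1 (K + 1), |Int.fract (Y ^ 3 / (k + θ) - η) - 1 / 2| :=
            abs_sum_le_sum_abs _ _
        _ ≤ ∑ k ∈ Ico 1 (K + 1), (1 / 2 : ℝ) := by
            refine sum_le_sum fun k _ => ?_
            have h1 := Int.fract_nonneg (Y ^ 3 / (k + θ) - η)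
            have h2 := Int.fract_lt_one (Y ^ 3 / (k + θ) - η)
            rw [abs_le]; constructor <;> linarith
        _ = K / 2 := by simp; ring
        _ ≤ Y * 1 * 1 := by linarith
        _ ≤ 136 * Y * (1 + Real.log Y) * ((n + 1 : ℕ) + 1) := by
            gcongr
            · linarith
            · linarith
            · have : (0 : ℝ) ≤ (n + 1 : ℕ) := by positivity
              linarith
    · have hK1 : 2 ≤ K := by
        have : (2 : ℝ) ≤ K := by linarith
        exact_mod_cast this
      have hdiv : (K : ℝ) ≤ 2 * ((K / 2 + 1 : ℕ) : ℝ) := by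
        exact_mod_cast (by omega : K ≤ 2 * (K / 2 + 1))
      have hle : ((K / 2 : ℕ) : ℝ) ≤ K := by exact_mod_cast Nat.div_le_self K 2
      have hle' : ((K / 2 + 1 : ℕ) : ℝ) ≤ K := by exact_mod_cast (by omega : K / 2 + 1 ≤ K)
      have h1 := ih (K / 2) (by rw [pow_succ] at hK; omega) (le_trans (by gcongr) hKY)
      have h2 := abs_sum_fract_hyperbola_dyadic_le η hY hθ0 hθ1 (M := K / 2 + 1) (N := K + 1)
        (by linarith) (le_trans (by gcongr) hKY) (by omega)
      rw [← sum_Ico_consecutive _ (by omega : 1 ≤ K / 2 + 1) (by omega : K / 2 + 1 ≤ K + 1)]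
      refine (abs_add_le _ _).trans ((add_le_add h1 h2).trans ?_)
      push_cast
      linarith

open Finset in
theorem exists_abs_sum_fract_hyperbola_le {ε : ℝ} (hε : 0 < ε) : ∃ C : ℝ, 0 ≤ C ∧ ∀ y θ η : ℝ,
    1 ≤ y → 0 ≤ θ → θ ≤ 1 →
    |∑ k ∈ Ico 1 (⌊√y⌋₊ + 1), (Int.fract (y / (k + θ) - η) - 1 / 2)| ≤ C * y ^ (1 / 3 + ε) := by
  -- Two logarithms are absorbed, one from the harmonic sum and one from the dyadic steps, so
  -- `Y^(1+2δ) = y^(1/3+ε)` is needed.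
  set δ : ℝ := 3 * ε / 2 with hδ
  have hδ0 : 0 < δ := by positivity
  refine ⟨408 * (1 + 1 / δ) ^ 2, by positivity, fun y θ η hy hθ0 hθ1 => ?_⟩
  have hy0 : 0 < y := by linarith
  set Y : ℝ := y ^ (1 / 3 : ℝ) with hYdef
  have hY : 1 ≤ Y := Real.one_le_rpow hy (by norm_num)
  have hY0 : 0 < Y := by linarith
  have hY3 : Y ^ 3 = y := by
    rw [hYdef, ← Real.rpow_natCast, ← Real.rpow_mul hy0.le]; norm_num
  set K : ℕ := ⌊√y⌋₊ with hK
  have hK1 : 1 ≤ K := Nat.le_floor (by simpa using hy)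
  have hKy : (K : ℝ) ^ 2 ≤ Y ^ 3 := by
    rw [hY3, ← Real.sq_sqrt hy0.le]
    gcongr
    exact Nat.floor_le (Real.sqrt_nonneg _)
  have hK0 : (0 : ℝ) < K := by exact_mod_cast hK1
  have hmain := abs_sum_fract_hyperbola_le η hY hθ0 hθ1 (Nat.log 2 K + 1) K
    (Nat.lt_pow_succ_log_self (by norm_num) K) hKy
  rw [hY3] at hmain
  have hlog := Real.log_nonneg hY
  have hn : (Nat.log 2 K : ℝ) ≤ 3 * Real.log Y := by
    have h1 : (Nat.log 2 K : ℝ) * Real.log 2 ≤ Real.log K := by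
      rw [← Real.log_pow]
      apply Real.log_le_log (by positivity)
      exact_mod_cast Nat.pow_log_le_self 2 (by omega)
    have h2 : 2 * Real.log K ≤ 3 * Real.log Y := by
      have := Real.log_le_log (by positivity) hKy
      rw [Real.log_pow, Real.log_pow] at this
      exact_mod_cast this
    have := Real.log_two_gt_d9
    have h0 : (0 : ℝ) ≤ Nat.log 2 K := by positivity
    nlinarith
  have hlogle : 1 + Real.log Y ≤ (1 + 1 / δ) * Y ^ δ := by
    have h1 := Real.log_le_rpow_div hY0.le hδ0
    have h2 := Real.one_le_rpow hY hδ0.le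
    have : (1 + 1 / δ) * Y ^ δ = Y ^ δ + Y ^ δ / δ := by ring
    linarith
  have hYpow : Y * (Y ^ δ) ^ 2 = y ^ (1 / 3 + ε) := by
    rw [← Real.rpow_natCast, ← Real.rpow_mul hY0.le, hYdef, ← Real.rpow_mul hy0.le,
      ← Real.rpow_add hy0]
    congr 1
    rw [hδ]; push_cast; ring
  calc _ ≤ _ := hmain
    _ ≤ 136 * Y * (1 + Real.log Y) * (3 * (1 + Real.log Y)) := by
      gcongr
      push_cast
      linarith
    _ = 408 * Y * (1 + Real.log Y) ^ 2 := by ring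
    _ ≤ 408 * Y * ((1 + 1 / δ) * Y ^ δ) ^ 2 := by gcongr
    _ = 408 * (1 + 1 / δ) ^ 2 * (Y * (Y ^ δ) ^ 2) := by ring
    _ = _ := by rw [hYpow]

/-! ### The shifted hyperbola method -/

theorem card_filter_mul_le_eq_floor {y c : ℝ} (hy : 0 ≤ y) (hc : 1 ≤ c) :
    ((Finset.Icc 1 ⌊y⌋₊).filter fun n : ℕ => n * c ≤ y).card = ⌊y / c⌋₊ := by
  have hc0 : 0 < c := by linarith
  have : ((Finset.Icc 1 ⌊y⌋₊).filter fun n : ℕ => n * c ≤ y) = Finset.Icc 1 ⌊y / c⌋₊ := by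
    ext n
    simp only [Finset.mem_filter, Finset.mem_Icc, Nat.le_floor_iff hy,
      Nat.le_floor_iff (div_nonneg hy hc0.le), le_div_iff₀ hc0]
    constructor
    · rintro ⟨⟨h1, -⟩, h3⟩; exact ⟨h1, h3⟩
    · rintro ⟨h1, h3⟩
      exact ⟨⟨h1, le_trans (le_mul_of_one_le_right (by positivity) hc) h3⟩, h3⟩
  rw [this]; simp

open Finset in
-- The sum counts pairs `(n, k)` with `n(k+θ) ≤ y`. If `k > K` then `n ≤ K`, so that part is counted
-- by `n` instead: `k` runs over `K < k ≤ y/n - θ`.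
theorem abs_sum_floor_sub_le {y θ : ℝ} (hy : 1 ≤ y) (hθ0 : 0 ≤ θ) (hθ1 : θ ≤ 1) :
    |∑ k ∈ Icc 1 ⌊y⌋₊, (⌊y / (k + θ)⌋₊ : ℝ) - ∑ k ∈ Ico 1 (⌊√y⌋₊ + 1),
      ((⌊y / (k + θ)⌋ : ℝ) + (⌊y / k - θ⌋ - ⌊√y⌋₊))| ≤ 1 := by
  have hy0 : 0 < y := by linarith
  set K : ℕ := ⌊√y⌋₊ with hK
  set N : ℕ := ⌊y⌋₊ with hN
  have hK1 : 1 ≤ K := Nat.le_floor (by simpa using hy)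
  have hsq := Real.sq_sqrt hy0.le
  have hKle : (K : ℝ) ≤ √y := Nat.floor_le (Real.sqrt_nonneg _)
  have hKlt : √y < K + 1 := Nat.lt_floor_add_one _
  have hK0 : (1 : ℝ) ≤ K := by exact_mod_cast hK1
  have hKy : (K : ℝ) ^ 2 ≤ y := by rw [← hsq]; gcongr
  have hKy' : y < ((K : ℝ) + 1) ^ 2 := by rw [← hsq]; gcongr
  have hKN : K ≤ N := Nat.le_floor (by nlinarith)
  have hfl : ∀ k ∈ Ico 1 (K + 1), ((⌊y / (k + θ)⌋ : ℤ) : ℝ) = (⌊y / (k + θ)⌋₊ : ℝ) := by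
    intro k _
    rw [natCast_floor_eq_intCast_floor (by positivity)]
  have hsplit : ∑ k ∈ Icc 1 N, (⌊y / (k + θ)⌋₊ : ℝ) =
      ∑ k ∈ Ico 1 (K + 1), (⌊y / (k + θ)⌋₊ : ℝ) + ∑ k ∈ Ico (K + 1) (N + 1), (⌊y / (k + θ)⌋₊ : ℝ) := by
    rw [sum_Ico_consecutive _ (by omega) (by omega)]
    rfl
  have hlarge : ∑ k ∈ Ico (K + 1) (N + 1), (⌊y / (k + θ)⌋₊ : ℝ) =
      ∑ n ∈ Ico 1 (K + 1), ((max (⌊y / n - θ⌋) K - K : ℤ) : ℝ) := by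
    have e1 : ∀ k ∈ Ico (K + 1) (N + 1), (⌊y / (k + θ)⌋₊ : ℝ) =
        ∑ n ∈ Ico 1 (K + 1), if n * ((k : ℝ) + θ) ≤ y then (1 : ℝ) else 0 := by
      intro k hk
      have hkK : K + 1 ≤ k := (mem_Ico.1 hk).1
      have hkr : (K : ℝ) + 1 ≤ k := by exact_mod_cast hkK
      rw [← card_filter_mul_le_eq_floor hy0.le (by linarith), sum_boole]
      congr 2
      ext n
      simp only [mem_filter, mem_Icc, mem_Ico]
      constructor
      · rintro ⟨⟨h1, h2⟩, h3⟩
        refine ⟨⟨h1, ?_⟩, h3⟩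
        by_contra hlt
        have : (K : ℝ) + 1 ≤ n := by exact_mod_cast (by omega : K + 1 ≤ n)
        nlinarith
      · rintro ⟨⟨h1, h2⟩, h3⟩
        exact ⟨⟨h1, by omega⟩, h3⟩
    rw [sum_congr rfl e1, sum_comm]
    refine sum_congr rfl fun n hn => ?_
    obtain ⟨hn1, hn2⟩ := mem_Ico.1 hn
    have hnr : (1 : ℝ) ≤ n := by exact_mod_cast hn1
    have hn0 : (0 : ℝ) < n := by linarith
    rw [sum_boole]
    have e2 : ((Ico (K + 1) (N + 1)).filter fun k : ℕ => n * ((k : ℝ) + θ) ≤ y) =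
        Ico (K + 1) ((max (⌊y / n - θ⌋) K).toNat + 1) := by
      ext k
      simp only [mem_filter, mem_Ico]
      have hiff : n * ((k : ℝ) + θ) ≤ y ↔ (k : ℤ) ≤ ⌊y / n - θ⌋ := by
        rw [Int.le_floor, le_sub_iff_add_le, le_div_iff₀ hn0, mul_comm]
        simp
      rw [hiff]
      constructor
      · rintro ⟨⟨h1, h2⟩, h3⟩
        exact ⟨h1, by omega⟩
      · rintro ⟨h1, h2⟩
        have h3 : (k : ℤ) ≤ ⌊y / n - θ⌋ := by omega
        refine ⟨⟨h1, ?_⟩, h3⟩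
        have h4 := hiff.2 h3
        have : k ≤ N := by
          apply Nat.le_floor
          have : (0 : ℝ) ≤ k := by positivity
          nlinarith
        omega
    rw [e2, Nat.card_Ico]
    have : (((max (⌊y / n - θ⌋) K).toNat + 1 - (K + 1) : ℕ) : ℤ) = max (⌊y / n - θ⌋) K - K := by
      omega
    rw [← this]
    push_cast
    rfl
  have hdiff : ∑ k ∈ Icc 1 N, (⌊y / (k + θ)⌋₊ : ℝ) - ∑ k ∈ Ico 1 (K + 1),
      ((⌊y / (k + θ)⌋ : ℝ) + (⌊y / k - θ⌋ - K)) =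
      ∑ n ∈ Ico 1 (K + 1), ((max (⌊y / n - θ⌋) K - ⌊y / n - θ⌋ : ℤ) : ℝ) := by
    rw [hsplit, hlarge, sum_add_distrib, sum_congr rfl hfl, add_sub_add_left_eq_sub,
      ← sum_sub_distrib]
    refine sum_congr rfl fun n _ => ?_
    push_cast
    ring
  -- The truncation at `K` is active only if `⌊y/n - θ⌋ < K`. That can happen only for `n = K`,
  -- where the deficit is at most `1`.
  rw [hdiff, sum_Ico_succ_top hK1]
  have hzero : ∑ n ∈ Ico 1 K, ((max (⌊y / n - θ⌋) K - ⌊y / n - θ⌋ : ℤ) : ℝ) = 0 := by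
    refine sum_eq_zero fun n hn => ?_
    obtain ⟨hn1, hn2⟩ := mem_Ico.1 hn
    have hn0 : (0 : ℝ) < n := by exact_mod_cast hn1
    have hnK : (n : ℝ) + 1 ≤ K := by exact_mod_cast hn2
    have : (K : ℤ) ≤ ⌊y / n - θ⌋ := by
      rw [Int.le_floor, le_sub_iff_add_le, le_div_iff₀ hn0]
      push_cast
      nlinarith
    rw [max_eq_left this]; simp
  have hlast : (K : ℤ) - 1 ≤ ⌊y / K - θ⌋ := by
    rw [Int.le_floor, le_sub_iff_add_le, le_div_iff₀ (by linarith)]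
    push_cast
    nlinarith
  rw [hzero, zero_add, ← Int.cast_abs]
  have : |max (⌊y / K - θ⌋) (K : ℤ) - ⌊y / K - θ⌋| ≤ 1 := by
    rw [abs_le]; omega
  exact_mod_cast this

/-! ### The main term series and the uniform asymptotics -/

theorem hasSum_one_div_add_mul_add_succ {a : ℝ} (ha : 0 < a) :
    HasSum (fun k : ℕ => 1 / ((a + k) * (a + k + 1))) (1 / a) := by
  rw [hasSum_iff_tendsto_nat_of_nonneg (fun k => by positivity)]
  have h : ∀ n : ℕ, ∑ k ∈ Finset.range n, 1 / ((a + k) * (a + k + 1)) = 1 / a - 1 / (a + n) := by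
    intro n
    induction n with
    | zero => simp
    | succ n ih =>
      rw [Finset.sum_range_succ, ih]
      have : a + n ≠ 0 := by positivity
      have : a + n + 1 ≠ 0 := by positivity
      push_cast
      rw [← add_assoc]
      field_simp
      ring
  simp_rw [h]
  have : Filter.Tendsto (fun n : ℕ => 1 / (a + n)) Filter.atTop (nhds 0) := by
    simp_rw [one_div]
    exact tendsto_inv_atTop_zero.comp
      (Filter.tendsto_atTop_add_const_left _ _ tendsto_natCast_atTop_atTop)
  simpa using this.const_sub (1 / a)

theorem summable_div_mul_add {θ : ℝ} (hθ0 : 0 ≤ θ) :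
    Summable fun k : ℕ => θ / ((k + 1 : ℝ) * (k + 1 + θ)) := by
  have h : Summable fun k : ℕ => θ * (1 / ((k + 1 : ℕ) : ℝ) ^ 2) :=
    ((summable_nat_add_iff 1).2 (Real.summable_one_div_nat_pow.2 one_lt_two)).mul_left θ
  refine h.of_nonneg_of_le (fun k => by positivity) fun k => ?_
  rw [mul_one_div]
  push_cast
  gcongr
  nlinarith

/-- Telescoping series place the tail between `θ/(K+1)` and `θ/K`. Since `y` is close to `K^2`, the
tail supplies the term `Kθ` produced by the shifts in `⌊y/k - θ⌋`. -/
theorem abs_mul_tsum_tail_sub_le {y θ : ℝ} (hy : 1 ≤ y) (hθ0 : 0 ≤ θ) (hθ1 : θ ≤ 1) {K : ℕ}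
    (hK1 : 1 ≤ K) (hK : (K : ℝ) ^ 2 ≤ y) (hK' : y ≤ ((K : ℝ) + 1) ^ 2) :
    |y * ∑' k : ℕ, θ / (((k + K : ℕ) + 1 : ℝ) * ((k + K : ℕ) + 1 + θ)) - K * θ| ≤ 3 := by
  have hK0 : (1 : ℝ) ≤ K := by exact_mod_cast hK1
  have hs := (summable_nat_add_iff K).2 (summable_div_mul_add hθ0)
  have hup : ∑' k : ℕ, θ / (((k + K : ℕ) + 1 : ℝ) * ((k + K : ℕ) + 1 + θ)) ≤ θ * (1 / K) := by
    refine hasSum_le (fun k => ?_) hs.hasSum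
      ((hasSum_one_div_add_mul_add_succ (a := K) (by linarith)).mul_left θ)
    rw [mul_one_div]
    push_cast
    have : (0 : ℝ) ≤ k := by positivity
    refine div_le_div_of_nonneg_left hθ0 (mul_pos (by linarith) (by linarith)) ?_
    nlinarith
  have hlo : θ * (1 / (K + 1)) ≤
      ∑' k : ℕ, θ / (((k + K : ℕ) + 1 : ℝ) * ((k + K : ℕ) + 1 + θ)) := by
    refine hasSum_le (fun k => ?_)
      ((hasSum_one_div_add_mul_add_succ (a := K + 1) (by linarith)).mul_left θ) hs.hasSum
    rw [mul_one_div]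
    push_cast
    have : (0 : ℝ) ≤ k := by positivity
    have e : ((K : ℝ) + 1 + k) * (K + 1 + k + 1) = (k + K + 1) * (k + K + 1 + 1) := by ring
    rw [e]
    gcongr
  set R := ∑' k : ℕ, θ / (((k + K : ℕ) + 1 : ℝ) * ((k + K : ℕ) + 1 + θ))
  have h1 : y * R ≤ K * θ + 3 := by
    calc y * R ≤ y * (θ * (1 / K)) := by gcongr
      _ = θ * (y / K) := by ring
      _ ≤ θ * (K + 3) := by
        gcongr
        rw [div_le_iff₀ (by linarith)]
        nlinarith
      _ ≤ _ := by nlinarith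
  have h2 : K * θ - 3 ≤ y * R := by
    calc K * θ - 3 ≤ θ * (K - 1) := by nlinarith
      _ ≤ θ * (y / (K + 1)) := by
        gcongr
        rw [le_div_iff₀ (by linarith)]
        nlinarith
      _ = y * (θ * (1 / (K + 1))) := by ring
      _ ≤ _ := by gcongr
  rw [abs_le]
  constructor <;> linarith

open Finset in
theorem exists_abs_sum_floor_sub_floor_le {ε : ℝ} (hε : 0 < ε) (hε' : ε ≤ 2 / 3) :
    ∃ C : ℝ, 0 ≤ C ∧ ∀ y θ : ℝ, 0 < y → 0 ≤ θ → θ ≤ 1 →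
    |∑ k ∈ Icc 1 ⌊y⌋₊, ((⌊y / k⌋₊ : ℝ) - ⌊y / (k + θ)⌋₊) -
      y * ∑' k : ℕ, θ / ((k + 1 : ℝ) * (k + 1 + θ))| ≤ C * y ^ (1 / 3 + ε) := by
  obtain ⟨C, hC, hbound⟩ := exists_abs_sum_fract_hyperbola_le hε
  refine ⟨4 * C + 5, by positivity, fun y θ hy0 hθ0 hθ1 => ?_⟩
  have hs := summable_div_mul_add hθ0
  -- For `y < 1`, which occurs when `d > x`, the floor sum is empty and the main term is `O(y)`.
  -- Here `ε ≤ 2/3` gives `y ≤ y^(1/3+ε)`.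
  rcases lt_or_ge y 1 with hy | hy
  · rw [Nat.floor_eq_zero.2 hy]
    have h1 : ∑' k : ℕ, θ / ((k + 1 : ℝ) * (k + 1 + θ)) ≤ 5 := by
      have h3 : ∑' k : ℕ, θ / ((k + 1 : ℝ) * (k + 1 + θ)) ≤
          ∑' k : ℕ, 2 * (1 / ((1 + (k : ℝ)) * (1 + k + 1))) := by
        refine hs.tsum_le_tsum (fun k => ?_)
          ((hasSum_one_div_add_mul_add_succ one_pos).mul_left 2).summable
        rw [mul_one_div, div_le_div_iff₀ (by positivity) (by positivity)]
        have hk : (0 : ℝ) ≤ k := by positivity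
        have : θ * ((1 + (k : ℝ)) * (1 + k + 1)) ≤ 1 * ((1 + (k : ℝ)) * (1 + k + 1)) := by gcongr
        nlinarith [mul_nonneg hk hθ0]
      rw [((hasSum_one_div_add_mul_add_succ one_pos).mul_left 2).tsum_eq] at h3
      linarith
    have h2 : 0 ≤ ∑' k : ℕ, θ / ((k + 1 : ℝ) * (k + 1 + θ)) := tsum_nonneg fun k => by positivity
    have h3 : y ≤ y ^ (1 / 3 + ε) := by
      conv_lhs => rw [← Real.rpow_one y]
      exact Real.rpow_le_rpow_of_exponent_ge hy0 hy.le (by linarith)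
    simp only [Icc_eq_empty_of_lt, zero_lt_one, sum_empty, zero_sub, abs_neg]
    rw [abs_of_nonneg (by positivity)]
    calc _ ≤ y * 5 := by gcongr
      _ ≤ y ^ (1 / 3 + ε) * (4 * C + 5) := by gcongr; linarith
      _ = _ := by ring
  · set K : ℕ := ⌊√y⌋₊ with hK
    have hK1 : 1 ≤ K := Nat.le_floor (by simpa using hy)
    have hsq := Real.sq_sqrt hy0.le
    have hKle : (K : ℝ) ≤ √y := Nat.floor_le (Real.sqrt_nonneg _)
    have hKlt : √y < K + 1 := Nat.lt_floor_add_one _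
    have hKy : (K : ℝ) ^ 2 ≤ y := by rw [← hsq]; gcongr
    have hKy' : y ≤ ((K : ℝ) + 1) ^ 2 := by rw [← hsq]; gcongr
    have hd0 := abs_sum_floor_sub_le hy le_rfl zero_le_one
    have hdθ := abs_sum_floor_sub_le hy hθ0 hθ1
    have htail := abs_mul_tsum_tail_sub_le hy hθ0 hθ1 hK1 hKy hKy'
    have p1 := hbound y 0 0 hy le_rfl zero_le_one
    have p2 := hbound y θ 0 hy hθ0 hθ1
    have p3 := hbound y 0 θ hy le_rfl zero_le_one
    have hone : 1 ≤ y ^ (1 / 3 + ε) := Real.one_le_rpow hy (by positivity)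
    simp only [add_zero, sub_zero] at hd0 p1 p2 p3
    have hts := hs.sum_add_tsum_nat_add K
    have hmain : ∑ k ∈ Ico 1 (K + 1), (((⌊y / k⌋ : ℝ) + (⌊y / k⌋ - K)) -
        ((⌊y / (k + θ)⌋ : ℝ) + (⌊y / k - θ⌋ - K))) =
        y * ∑ k ∈ range K, θ / ((k + 1 : ℝ) * (k + 1 + θ)) + K * θ
        - 2 * ∑ k ∈ Ico 1 (K + 1), (Int.fract (y / k) - 1 / 2)
        + ∑ k ∈ Ico 1 (K + 1), (Int.fract (y / (k + θ)) - 1 / 2)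
        + ∑ k ∈ Ico 1 (K + 1), (Int.fract (y / k - θ) - 1 / 2) := by
      have e : y * ∑ k ∈ range K, θ / ((k + 1 : ℝ) * (k + 1 + θ)) + K * θ =
          ∑ k ∈ Ico 1 (K + 1), (y / k - y / (k + θ) + θ) := by
        rw [sum_Ico_eq_sum_range, Nat.add_sub_cancel, sum_add_distrib, mul_sum]
        congr 1
        · refine sum_congr rfl fun k _ => ?_
          have : (1 : ℝ) + k + θ ≠ 0 := by positivity
          have : (1 : ℝ) + k ≠ 0 := by positivity
          rw [add_comm (k : ℝ) 1]
          push_cast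
          field_simp
          ring
        · simp
      rw [e, mul_sum, ← sum_sub_distrib, ← sum_add_distrib, ← sum_add_distrib]
      refine sum_congr rfl fun k _ => ?_
      unfold Int.fract
      ring
    rw [sum_sub_distrib] at hmain ⊢
    rw [← hts]
    rw [abs_le] at hd0 hdθ htail p1 p2 p3 ⊢
    -- The constant `4C + 5` collects the sawtooth sums with weights `2, 1, 1`, two hyperbola errors
    -- of `1`, and the tail error `3`.
    constructor <;> linarith

/-! ### Counting `n` with `d ∣ [x/n]` -/

open Finset in
theorem card_filter_floor_div_eq {x : ℝ} (hx : 0 ≤ x) {m : ℕ} (hm : 1 ≤ m) :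
    (((Icc 1 ⌊x⌋₊).filter fun n : ℕ => ⌊x / n⌋₊ = m).card : ℝ) =
      ⌊x / m⌋₊ - ⌊x / (m + 1)⌋₊ := by
  have hm0 : (1 : ℝ) ≤ m := by exact_mod_cast hm
  have hle : ⌊x / (m + 1)⌋₊ ≤ ⌊x / m⌋₊ := by
    apply Nat.floor_le_floor; gcongr; linarith
  have : ((Icc 1 ⌊x⌋₊).filter fun n : ℕ => ⌊x / n⌋₊ = m) = Ioc ⌊x / (m + 1)⌋₊ ⌊x / m⌋₊ := by
    ext n
    simp only [mem_filter, mem_Icc, mem_Ioc]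
    rw [Nat.floor_lt (by positivity), Nat.le_floor_iff (a := x / m) (by positivity),
      Nat.le_floor_iff hx,
      div_lt_iff₀ (by positivity), le_div_iff₀ (by positivity)]
    constructor
    · rintro ⟨⟨h1, h2⟩, h3⟩
      have hn : (0 : ℝ) < n := by exact_mod_cast h1
      rw [Nat.floor_eq_iff (by positivity), le_div_iff₀ hn, div_lt_iff₀ hn] at h3
      constructor <;> linarith
    · rintro ⟨h1, h2⟩
      have hn : (0 : ℝ) < n := by
        by_contra h
        have : (n : ℝ) = 0 := le_antisymm (not_lt.1 h) (by positivity)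
        rw [this] at h1
        linarith
      refine ⟨⟨by exact_mod_cast hn, by nlinarith⟩, ?_⟩
      rw [Nat.floor_eq_iff (by positivity), le_div_iff₀ hn, div_lt_iff₀ hn]
      constructor <;> linarith
  rw [this, Nat.card_Ioc, Nat.cast_sub hle]

theorem one_le_floor_div {x : ℝ} (hx : 0 ≤ x) {n : ℕ} (hn : n ∈ Finset.Icc 1 ⌊x⌋₊) :
    1 ≤ ⌊x / n⌋₊ ∧ ⌊x / n⌋₊ ≤ ⌊x⌋₊ := by
  obtain ⟨h1, h2⟩ := Finset.mem_Icc.1 hn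
  have hn1 : (1 : ℝ) ≤ n := by exact_mod_cast h1
  rw [Nat.le_floor_iff hx] at h2
  constructor
  · apply Nat.le_floor
    rw [le_div_iff₀ (by linarith)]
    simpa using h2
  · exact Nat.floor_le_floor (div_le_self hx hn1)

open Finset in
-- Sort by `k = [x/n]/d`: the value `dk` is taken `[x/(dk)] - [x/(dk+1)]` times, and `dk + 1 = d(k +
-- 1/d)`.
theorem card_filter_dvd_floor_div {x : ℝ} (hx : 0 ≤ x) {d : ℕ} (hd : 1 ≤ d) :
    (((Icc 1 ⌊x⌋₊).filter fun n : ℕ => d ∣ ⌊x / n⌋₊).card : ℝ) =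
      ∑ k ∈ Icc 1 ⌊x / d⌋₊, ((⌊x / d / k⌋₊ : ℝ) - ⌊x / d / (k + 1 / d)⌋₊) := by
  have hd0 : (0 : ℝ) < d := by exact_mod_cast hd
  have hmaps : ∀ n ∈ (Icc 1 ⌊x⌋₊).filter (fun n : ℕ => d ∣ ⌊x / n⌋₊),
      ⌊x / n⌋₊ / d ∈ Icc 1 ⌊x / d⌋₊ := by
    intro n hn
    obtain ⟨hn1, hn2⟩ := mem_filter.1 hn
    obtain ⟨h1, h2⟩ := one_le_floor_div hx hn1
    rw [mem_Icc, Nat.floor_div_natCast x d]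
    exact ⟨Nat.div_pos (Nat.le_of_dvd h1 hn2) hd, Nat.div_le_div_right h2⟩
  rw [card_eq_sum_card_fiberwise hmaps]
  push_cast
  refine sum_congr rfl fun k hk => ?_
  have hk1 := (mem_Icc.1 hk).1
  have hk0 : (0 : ℝ) < k := by exact_mod_cast hk1
  have hset : ((Icc 1 ⌊x⌋₊).filter (fun n : ℕ => d ∣ ⌊x / n⌋₊)).filter
      (fun n : ℕ => ⌊x / n⌋₊ / d = k) = (Icc 1 ⌊x⌋₊).filter fun n : ℕ => ⌊x / n⌋₊ = d * k := by
    ext n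
    simp only [mem_filter, and_assoc, and_congr_right_iff]
    intro _
    constructor
    · rintro ⟨h1, h2⟩
      rw [← h2, Nat.mul_div_cancel' h1]
    · intro h
      rw [h]
      exact ⟨dvd_mul_right _ _, Nat.mul_div_cancel_left _ hd⟩
  rw [hset, card_filter_floor_div_eq hx (Nat.mul_pos hd hk1)]
  have e1 : x / ((d * k : ℕ) : ℝ) = x / d / k := by push_cast; field_simp
  have e2 : x / (((d * k : ℕ) : ℝ) + 1) = x / d / (k + 1 / d) := by push_cast; field_simp
  rw [e1, e2]

open Finset in
-- The range of `d` is a fixed `N` rather than `m`, so that the sum over `d` can later be exchanged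
-- with the sum over `n`.
theorem id_mul_apply_div (g : ArithmeticFunction ℂ) {m N : ℕ} (hm : 1 ≤ m) (hN : m ≤ N) :
    ((ArithmeticFunction.id : ArithmeticFunction ℂ) * g) m / m =
      ∑ d ∈ Icc 1 N, if d ∣ m then g d / d else 0 := by
  have hm0 : (m : ℂ) ≠ 0 := by exact_mod_cast (by omega : m ≠ 0)
  rw [ArithmeticFunction.mul_apply,
    Nat.sum_divisorsAntidiagonal' (f := fun i j => (ArithmeticFunction.id : ArithmeticFunction ℂ) i * g j),
    ← sum_filter, sum_div]
  have hset : m.divisors = (Icc 1 N).filter (· ∣ m) := by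
    ext d
    simp only [Nat.mem_divisors, mem_filter, mem_Icc]
    constructor
    · rintro ⟨h1, -⟩
      exact ⟨⟨Nat.pos_of_dvd_of_pos h1 hm, (Nat.le_of_dvd hm h1).trans hN⟩, h1⟩
    · rintro ⟨-, h1⟩
      exact ⟨h1, by omega⟩
  rw [hset]
  refine sum_congr rfl fun d hd => ?_
  obtain ⟨hd1, k, rfl⟩ := mem_filter.1 hd
  have hd1' := (mem_Icc.1 hd1).1
  have hd0 : (d : ℂ) ≠ 0 := by exact_mod_cast (by omega : d ≠ 0)
  rw [Nat.mul_div_cancel_left _ hd1']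
  push_cast at hm0
  have hk0 : (k : ℂ) ≠ 0 := right_ne_zero_of_mul hm0
  simp only [ArithmeticFunction.natCoe_apply, ArithmeticFunction.id_apply]
  push_cast
  field_simp

open Finset in
theorem hasSum_sum_id_mul_floor_div (g : ArithmeticFunction ℂ) {x : ℝ} (hx : 0 ≤ x) :
    HasSum (fun d : ℕ => g d / d *
        ((((Icc 1 ⌊x⌋₊).filter fun n : ℕ => d ∣ ⌊x / n⌋₊).card : ℝ) : ℂ))
      (∑ n ∈ Icc 1 ⌊x⌋₊,
        ((ArithmeticFunction.id : ArithmeticFunction ℂ) * g) ⌊x / (n : ℝ)⌋₊ / (⌊x / (n : ℝ)⌋₊ : ℂ)) := by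
  have h1 : ∑ n ∈ Icc 1 ⌊x⌋₊,
        ((ArithmeticFunction.id : ArithmeticFunction ℂ) * g) ⌊x / (n : ℝ)⌋₊ / (⌊x / (n : ℝ)⌋₊ : ℂ) =
      ∑ d ∈ Icc 1 ⌊x⌋₊, g d / d *
        ((((Icc 1 ⌊x⌋₊).filter fun n : ℕ => d ∣ ⌊x / n⌋₊).card : ℝ) : ℂ) := by
    rw [sum_congr rfl fun n hn => id_mul_apply_div g (one_le_floor_div hx hn).1
      (one_le_floor_div hx hn).2, sum_comm]
    refine sum_congr rfl fun d _ => ?_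
    rw [← sum_filter, sum_const, nsmul_eq_mul, mul_comm]
    push_cast
    rfl
  rw [h1]
  refine hasSum_sum_of_ne_finset_zero fun d hd => ?_
  rcases Nat.eq_zero_or_pos d with rfl | hd0
  · simp
  · have : ((Icc 1 ⌊x⌋₊).filter fun n : ℕ => d ∣ ⌊x / n⌋₊) = ∅ := by
      refine filter_eq_empty_iff.2 fun n hn hdvd => hd ?_
      obtain ⟨h1, h2⟩ := one_le_floor_div hx hn
      exact mem_Icc.2 ⟨hd0, (Nat.le_of_dvd h1 hdvd).trans h2⟩
    rw [this]; simp

/-! ### Summation over `d` -/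

theorem summable_pnat_rpow {p : ℝ} (hp : p < -1) : Summable fun n : ℕ+ => (n : ℝ) ^ p :=
  (Real.summable_nat_rpow.2 hp).comp_injective PNat.coe_injective

theorem summable_div_mul_pnat (g : ArithmeticFunction ℂ) {C : ℝ}
    (hg : ∀ n : ℕ, 1 ≤ n → ‖g n‖ ≤ C * (n : ℝ) ^ (1 / 6 : ℝ)) :
    Summable fun p : ℕ+ × ℕ+ =>
      g p.2 / ((p.2 : ℂ) * ((p.1 * p.2 : ℂ) * (p.1 * p.2 + 1))) := by
  have h := ((summable_pnat_rpow (p := -2) (by norm_num)).mul_of_nonneg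
    (summable_pnat_rpow (p := -2) (by norm_num)) (fun n => by positivity)
    (fun n => by positivity)).mul_left C
  refine h.of_norm_bounded fun p => ?_
  obtain ⟨k, d⟩ := p
  have hk : (1 : ℝ) ≤ k := by exact_mod_cast k.pos
  have hd : (1 : ℝ) ≤ d := by exact_mod_cast d.pos
  have hgd := hg d d.pos
  have hC : 0 ≤ C := by
    have := (norm_nonneg _).trans hgd
    exact nonneg_of_mul_nonneg_left this (by positivity)
  have hpow : (d : ℝ) ^ (1 / 6 : ℝ) ≤ d := by
    conv_rhs => rw [← Real.rpow_one (d : ℝ)]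
    exact Real.rpow_le_rpow_of_exponent_le hd (by norm_num)
  have hnorm : ‖((d : ℂ) * ((k * d : ℂ) * (k * d + 1)))‖ = (d : ℝ) * ((k * d) * (k * d + 1)) := by
    have : ((d : ℂ) * ((k * d : ℂ) * (k * d + 1))) =
        (((d : ℝ) * ((k * d) * (k * d + 1)) : ℝ) : ℂ) := by push_cast; rfl
    rw [this, Complex.norm_real, Real.norm_of_nonneg (by positivity)]
  simp only
  rw [norm_div, hnorm, div_le_iff₀ (by positivity)]
  refine hgd.trans ?_
  rw [mul_assoc]
  gcongr
  refine hpow.trans ?_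
  have e : ∀ t : ℝ, t ^ (-2 : ℝ) = (t ^ 2)⁻¹ := fun t => by
    rw [show (-2 : ℝ) = ((-2 : ℤ) : ℝ) by norm_num, Real.rpow_intCast]; rfl
  rw [e, e]
  calc (d : ℝ) = ((k : ℝ) ^ 2)⁻¹ * ((d : ℝ) ^ 2)⁻¹ * (d * ((k * d) * (k * d))) := by field_simp
    _ ≤ _ := by gcongr; linarith

/-- Both series are groupings of the absolutely convergent double series of `g(d)/(d · kd ·
(kd+1))`: by the product `m = kd`, or by `d`. -/
theorem exists_hasSum_id_mul_div (g : ArithmeticFunction ℂ) {C : ℝ}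
    (hg : ∀ n : ℕ, 1 ≤ n → ‖g n‖ ≤ C * (n : ℝ) ^ (1 / 6 : ℝ)) :
    ∃ A : ℂ, HasSum (fun m : ℕ+ => ((ArithmeticFunction.id : ArithmeticFunction ℂ) * g) m /
        ((m : ℂ) ^ 2 * ((m : ℂ) + 1))) A ∧
      HasSum (fun d : ℕ => g d / d * ((1 / d *
        ∑' k : ℕ, (1 / d : ℝ) / ((k + 1 : ℝ) * (k + 1 + 1 / d)) : ℝ) : ℂ)) A := by
  obtain ⟨A, hs⟩ := summable_div_mul_pnat g hg
  refine ⟨A, ?_, ?_⟩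
  · refine (sigmaAntidiagonalEquivProd.hasSum_iff.2 hs).sigma fun n => ?_
    have hn : (n : ℂ) ≠ 0 := by exact_mod_cast n.ne_zero
    have hn' : (n : ℂ) + 1 ≠ 0 := Nat.cast_add_one_ne_zero (n : ℕ)
    have e : ((ArithmeticFunction.id : ArithmeticFunction ℂ) * g) n /
        ((n : ℂ) ^ 2 * ((n : ℂ) + 1)) = ∑ c : Nat.divisorsAntidiagonal n,
          (c.1.1 : ℂ) * g c.1.2 / ((n : ℂ) ^ 2 * ((n : ℂ) + 1)) := by
      rw [ArithmeticFunction.mul_apply, ← Finset.sum_div,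
        Finset.sum_coe_sort _ (fun c : ℕ × ℕ => (c.1 : ℂ) * g c.2)]
      rfl
    rw [e]
    convert! hasSum_fintype (fun c : Nat.divisorsAntidiagonal n =>
      (c.1.1 : ℂ) * g c.1.2 / ((n : ℂ) ^ 2 * ((n : ℂ) + 1))) using 1
    ext c
    have hc := (Nat.mem_divisorsAntidiagonal.1 c.2).1
    have hc' : (c.1.1 : ℂ) * c.1.2 = n := by exact_mod_cast hc
    have h1 : (c.1.1 : ℂ) ≠ 0 := fun h => hn (by rw [← hc', h, zero_mul])
    have h2 : (c.1.2 : ℂ) ≠ 0 := fun h => hn (by rw [← hc', h, mul_zero])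
    simp only [sigmaAntidiagonalEquivProd, divisorsAntidiagonalFactors, Function.comp_apply,
      Equiv.coe_fn_mk, PNat.mk_coe]
    rw [hc', ← hc']
    rw [← hc'] at hn'
    field_simp
  · have h2 : HasSum (fun d : ℕ+ => g d / (d : ℂ) * ((1 / d *
        ∑' k : ℕ, (1 / d : ℝ) / ((k + 1 : ℝ) * (k + 1 + 1 / d)) : ℝ) : ℂ)) A := by
      refine ((Equiv.prodComm ℕ+ ℕ+).hasSum_iff.2 hs).prod_fiberwise fun d => ?_
      have hd0 : (0 : ℝ) < d := by exact_mod_cast d.pos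
      have hdc : (d : ℂ) ≠ 0 := by exact_mod_cast d.ne_zero
      rw [← Equiv.pnatEquivNat.symm.hasSum_iff]
      have h3 := (summable_div_mul_add (θ := 1 / d) (by positivity)).hasSum
      have h4 := (Complex.hasSum_ofReal.2 (h3.mul_left (1 / (d : ℝ)))).mul_left (g d / (d : ℂ))
      convert! h4 using 1
      ext k
      have e1 : ((k : ℂ) + 1) * d + 1 ≠ 0 := by
        exact_mod_cast Nat.succ_ne_zero ((k + 1) * d)
      have e2 : (k : ℂ) + 1 ≠ 0 := Nat.cast_add_one_ne_zero k
      have e3 : (k : ℂ) + 1 + 1 / d ≠ 0 := by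
        intro h
        apply e1
        have : ((k : ℂ) + 1) * d + 1 = (k + 1 + 1 / d) * d := by field_simp
        rw [this, h, zero_mul]
      simp only [Function.comp_apply, Equiv.prodComm_apply, Prod.swap_prod_mk,
        Equiv.pnatEquivNat_symm_apply, Nat.succPNat_coe, Nat.succ_eq_add_one]
      push_cast
      field_simp
    -- Including `d = 0` is harmless, because division by zero makes that term `0`.
    refine (PNat.coe_injective.hasSum_iff ?_).1 h2
    intro d hd
    have : d = 0 := by
      by_contra h
      exact hd ⟨⟨d, Nat.pos_of_ne_zero h⟩, rfl⟩
    subst this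
    simp

open Filter Asymptotics in
-- The uniform bound is applied for every `d`, including `d > x`. The exponent `1/6` lies below
-- `1/3`, so the weights `d^(1/6 - 1 - 1/3 - ε) = d^(-7/6 - ε)` are summable.
theorem isBigO_sum_id_mul_floor_div_sub (g : ArithmeticFunction ℂ) {C : ℝ}
    (hg : ∀ n : ℕ, 1 ≤ n → ‖g n‖ ≤ C * (n : ℝ) ^ (1 / 6 : ℝ)) {A : ℂ}
    (hA : HasSum (fun d : ℕ => g d / d * ((1 / d *
        ∑' k : ℕ, (1 / d : ℝ) / ((k + 1 : ℝ) * (k + 1 + 1 / d)) : ℝ) : ℂ)) A)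
    {ε : ℝ} (hε : 0 < ε) (hε' : ε ≤ 2 / 3) :
    (fun x : ℝ => (∑ n ∈ Finset.Icc 1 ⌊x⌋₊,
        ((ArithmeticFunction.id : ArithmeticFunction ℂ) * g) ⌊x / (n : ℝ)⌋₊ / (⌊x / (n : ℝ)⌋₊ : ℂ))
          - (x : ℂ) * A) =O[atTop] fun x : ℝ => x ^ (1 / 3 + ε) := by
  obtain ⟨B, hB, hbound⟩ := exists_abs_sum_floor_sub_floor_le hε hε'
  have hsum : Summable fun d : ℕ => (d : ℝ) ^ (-(7 / 6) - ε) :=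
    Real.summable_nat_rpow.2 (by linarith)
  have hC : 0 ≤ C := by
    have := (norm_nonneg _).trans (hg 1 le_rfl)
    simpa using this
  refine IsBigO.of_bound (C * B * ∑' d : ℕ, (d : ℝ) ^ (-(7 / 6) - ε)) ?_
  filter_upwards [eventually_gt_atTop 0] with x hx
  have h := (hasSum_sum_id_mul_floor_div g hx.le).sub (hA.mul_left (x : ℂ))
  have hb := hsum.hasSum.mul_left (C * B * x ^ (1 / 3 + ε))
  rw [Real.norm_of_nonneg (by positivity)]
  calc _ ≤ C * B * x ^ (1 / 3 + ε) * ∑' d : ℕ, (d : ℝ) ^ (-(7 / 6) - ε) := by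
        refine h.norm_le_of_bounded hb fun d => ?_
        rcases Nat.eq_zero_or_pos d with rfl | hd
        · simp; positivity
        have hd0 : (0 : ℝ) < d := by exact_mod_cast hd
        have hd1 : (1 : ℝ) ≤ d := by exact_mod_cast hd
        have hdb := hbound (x / d) (1 / d) (by positivity) (by positivity)
          (by rw [div_le_one hd0]; exact hd1)
        rw [← card_filter_dvd_floor_div hx.le hd] at hdb
        set t : ℝ := (((Finset.Icc 1 ⌊x⌋₊).filter fun n : ℕ => d ∣ ⌊x / n⌋₊).card : ℝ)
        set R : ℝ := ∑' k : ℕ, (1 / d : ℝ) / ((k + 1 : ℝ) * (k + 1 + 1 / d))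
        have e : g d / d * ((t : ℝ) : ℂ) - x * (g d / d * ((1 / d * R : ℝ) : ℂ)) =
            g d / d * ((t - x / d * R : ℝ) : ℂ) := by
          push_cast; ring
        rw [e, norm_mul, norm_div, Complex.norm_natCast, Complex.norm_real, Real.norm_eq_abs]
        calc _ ≤ C * (d : ℝ) ^ (1 / 6 : ℝ) / d * (B * (x / d) ^ (1 / 3 + ε)) := by
              gcongr
              exact hg d hd
          _ = C * B * x ^ (1 / 3 + ε) * ((d : ℝ) ^ (1 / 6 : ℝ) / d / d ^ (1 / 3 + ε)) := by
              rw [Real.div_rpow hx.le hd0.le]; ring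
          _ = _ := by
              congr 1
              nth_rewrite 2 [← Real.rpow_one (d : ℝ)]
              rw [← Real.rpow_sub hd0, ← Real.rpow_sub hd0]
              congr 1; ring
    _ = _ := by ring

theorem theorem2 (f g : ArithmeticFunction ℂ)
    (hf : f = (ArithmeticFunction.id : ArithmeticFunction ℂ) * g)
    (hg : ∀ ε : ℝ, 0 < ε → ∃ C : ℝ, ∀ n : ℕ, 1 ≤ n → ‖g n‖ ≤ C * (n : ℝ) ^ ε) :
    (Summable fun m : ℕ+ => f m / ((m : ℂ) ^ 2 * ((m : ℂ) + 1))) ∧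
    ∀ ε : ℝ, 0 < ε →
      (fun x : ℝ =>
        (∑ n ∈ Finset.Icc 1 ⌊x⌋₊, f ⌊x / (n : ℝ)⌋₊ / (⌊x / (n : ℝ)⌋₊ : ℂ))
          - (x : ℂ) * ∑' m : ℕ+, f m / ((m : ℂ) ^ 2 * ((m : ℂ) + 1)))
        =O[Filter.atTop] (fun x : ℝ => x ^ (1 / 3 + ε)) := by
  subst hf
  obtain ⟨C, hC⟩ := hg (1 / 6) (by norm_num)
  obtain ⟨A, hA1, hA2⟩ := exists_hasSum_id_mul_div g hC
  refine ⟨hA1.summable, fun ε hε => ?_⟩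
  rw [hA1.tsum_eq]
  -- A larger `ε` only weakens the claim once `x ≥ 1`, so it may be capped at `2/3`.
  refine (isBigO_sum_id_mul_floor_div_sub g hC hA2 (ε := min ε (2 / 3))
    (lt_min hε (by norm_num)) (min_le_right _ _)).trans ?_
  refine Asymptotics.IsBigO.of_bound 1 ?_
  filter_upwards [Filter.eventually_ge_atTop 1] with x hx
  rw [one_mul, Real.norm_of_nonneg (by positivity), Real.norm_of_nonneg (by positivity)]
  exact Real.rpow_le_rpow_of_exponent_le hx (by gcongr; exact min_le_left _ _)
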